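/- Let $X$ be a finite-dimensional vector space over $\mathbb{K}=\mathbb{R}$ or $\mathbb{C}$ with an inner product $\langle\cdot,\cdot\rangle$ (Hermitian in the complex case), and let $G(X)=\bigcup_{k=0}^{\dim X} G_k(X)$ be its full Grassmannian, the set of all linear subspaces of $X$, where $G_k(X)$ is the set of $k$-dimensional subspaces. For nonzero subspaces $V,W\subset X$ with $p=\dim V$, $q=\dim W$ and $m=\min\{p,q\}$, the principal angles $0\le\theta_1\le\dots\le\theta_m\le\frac{\pi}{2}$ of $V$ and $W$ are the uniquely determined numbers for which there are orthonormal bases $(e_1,\dots,e_p)$ of $V$ and $(f_1,\dots,f_q)$ of $W$ with $\langle e_i,f_j\rangle=\delta_{ij}\cos\theta_i$ for all $1\le i\le p$, $1\le j\le q$. The Grassmann angle $\Theta_{V,W}\in[0,\frac{\pi}{2}]$ of $V$ with $W$ is $$\Theta_{V,W}=\begin{cases}\arccos(\cos\theta_1\cdots\cos\theta_m) & \text{if } \dim V\le\dim W,\\ \frac{\pi}{2} & \text{if } \dim V>\dim W,\end{cases}$$ and moreover $\Theta_{\{0\},W}=0$ for every subspace $W$ (including $W=\{0\}$) and $\Theta_{V,\{0\}}=\frac{\pi}{2}$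 for $V\ne\{0\}$. Theorem. The Grassmann angle is an asymmetric metric on $G(X)$. That is, $G(X)$ is non-empty and, for all $U,V,W\in G(X)$, 1. $\Theta_{V,W}\ge 0$; 2. $\Theta_{V,W}=\Theta_{W,V}=0$ if and only if $V=W$; 3. $\Theta_{U,W}\le\Theta_{U,V}+\Theta_{V,W}$. -/

import Mathlib

/-- Orthonormal bases `e = (e₁, …, e_p)` of `V` and `f = (f₁, …, f_q)` of `W` are associated
principal bases, with principal angles `0 ≤ θ₁ ≤ … ≤ θ_m ≤ π / 2` where `m = min p q`, if
`⟪e i, f j⟫ = δ_ij cos (θ i)`. -/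
structure IsPrincipal {𝕜 X : Type*} [RCLike 𝕜] [NormedAddCommGroup X] [InnerProductSpace 𝕜 X]
    [FiniteDimensional 𝕜 X] (V W : Submodule 𝕜 X)
    (e : OrthonormalBasis (Fin (Module.finrank 𝕜 V)) 𝕜 V)
    (f : OrthonormalBasis (Fin (Module.finrank 𝕜 W)) 𝕜 W)
    (θ : Fin (min (Module.finrank 𝕜 V) (Module.finrank 𝕜 W)) → ℝ) : Prop where
  nonneg : ∀ k, 0 ≤ θ k
  le_pi_div_two : ∀ k, θ k ≤ Real.pi / 2
  monotone : Monotone θ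
  inner_eq : ∀ (i : Fin (Module.finrank 𝕜 V)) (j : Fin (Module.finrank 𝕜 W)),
    inner 𝕜 (e i : X) (f j : X) =
      if h : (i : ℕ) = (j : ℕ) then
        ((Real.cos (θ ⟨i, lt_min i.isLt (h ▸ j.isLt)⟩) : ℝ) : 𝕜)
      else 0

/-- `θ` is a list of principal angles of `V` and `W`. -/
def IsPrincipalAngles {𝕜 X : Type*} [RCLike 𝕜] [NormedAddCommGroup X] [InnerProductSpace 𝕜 X]
    [FiniteDimensional 𝕜 X] (V W : Submodule 𝕜 X)
    (θ : Fin (min (Module.finrank 𝕜 V) (Module.finrank 𝕜 W)) → ℝ) : Prop :=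
  ∃ (e : OrthonormalBasis (Fin (Module.finrank 𝕜 V)) 𝕜 V)
    (f : OrthonormalBasis (Fin (Module.finrank 𝕜 W)) 𝕜 W), IsPrincipal V W e f θ

/-- Principal angles exist (singular value decomposition of the projection `V → W`). -/
theorem exists_isPrincipalAngles {𝕜 X : Type*} [RCLike 𝕜] [NormedAddCommGroup X]
    [InnerProductSpace 𝕜 X] [FiniteDimensional 𝕜 X] (V W : Submodule 𝕜 X) :
    ∃ θ, IsPrincipalAngles V W θ := by
  set p := Module.finrank 𝕜 V with hp
  set q := Module.finrank 𝕜 W with hq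
  let T : V →ₗ[𝕜] W := (W.orthogonalProjectionOnto : X →ₗ[𝕜] W) ∘ₗ V.subtype
  let σ : ℕ → ℝ := T.singularValues
  have hσ0 : ∀ i, 0 ≤ σ i := T.singularValues_nonneg
  have hσa : Antitone σ := T.singularValues_antitone
  let e : OrthonormalBasis (Fin p) 𝕜 V := T.isSymmetric_adjoint_comp_self.eigenvectorBasis hp.symm
  have hTT : ∀ i j, inner 𝕜 (T (e i)) (T (e j)) = if i = j then ((σ i : 𝕜)) ^ 2 else 0 := by
    intro i j
    have h1 : (LinearMap.adjoint T ∘ₗ T) (e j) = ((σ j ^ 2 : ℝ) : 𝕜) • e j := by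
      rw [T.sq_singularValues_fin hp.symm j]
      exact T.isSymmetric_adjoint_comp_self.apply_eigenvectorBasis hp.symm j
    rw [← LinearMap.adjoint_inner_right, ← LinearMap.comp_apply, h1, inner_smul_right,
      OrthonormalBasis.inner_eq_ite]
    split_ifs with h
    · subst h; simp
    · simp
  have hnorm : ∀ i, ‖T (e i)‖ = σ i := by
    intro i
    have h := hTT i i
    rw [inner_self_eq_norm_sq_to_K, if_pos rfl] at h
    have h' : ‖T (e i)‖ ^ 2 = σ i ^ 2 := by exact_mod_cast h
    exact (pow_left_inj₀ (norm_nonneg _) (hσ0 _) two_ne_zero).1 h'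
  have hle1 : ∀ i : Fin p, σ i ≤ 1 := by
    intro i
    rw [← hnorm i]
    have h : ‖T (e i)‖ ≤ ‖(e i : X)‖ := W.norm_orthogonalProjectionOnto_apply_le (e i : X)
    have h2 : ‖(e i : X)‖ = 1 := e.orthonormal.1 i
    linarith
  -- the normalised images are orthonormal
  let u : Fin p → W := fun i => ((σ i : 𝕜)⁻¹) • T (e i)
  have huu : ∀ i j : Fin p, σ i ≠ 0 → inner 𝕜 (u i) (u j) = if i = j then (1 : 𝕜) else 0 := by
    intro i j hi
    simp only [u, inner_smul_left, inner_smul_right, hTT]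
    split_ifs with h
    · subst h
      have : (σ i : 𝕜) ≠ 0 := by exact_mod_cast hi
      simp only [map_inv₀, RCLike.conj_ofReal]
      field_simp
    · simp
  have hTu : ∀ i : Fin p, σ i ≠ 0 → T (e i) = (σ i : 𝕜) • u i := by
    intro i hi
    have : (σ i : 𝕜) ≠ 0 := by exact_mod_cast hi
    simp [u, smul_smul, this]
  -- nonzero singular values have an index below `q`
  have hlt : ∀ i : Fin p, σ i ≠ 0 → (i : ℕ) < q := by
    intro i hi
    have ho : Orthonormal 𝕜
        (fun k : Fin ((i : ℕ) + 1) => u ⟨k, lt_of_lt_of_le k.isLt i.isLt⟩) := by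
      rw [orthonormal_iff_ite]
      intro a b
      have ha : σ a ≠ 0 := by
        have h1 : σ i ≤ σ a := hσa (Nat.lt_succ_iff.1 a.isLt)
        have h2 : 0 < σ i := lt_of_le_of_ne (hσ0 _) (Ne.symm hi)
        exact (lt_of_lt_of_le h2 h1).ne'
      rw [huu _ _ ha]
      simp [Fin.ext_iff]
    have := ho.linearIndependent.fintype_card_le_finrank
    simpa using this
  let v : Fin q → W := fun j => if h : (j : ℕ) < p then u ⟨j, h⟩ else 0
  let s : Set (Fin q) := {j | (j : ℕ) < p ∧ σ j ≠ 0}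
  have hv : Orthonormal 𝕜 (s.domRestrict v) := by
    rw [orthonormal_iff_ite]
    rintro ⟨a, ha, ha'⟩ ⟨b, hb, hb'⟩
    have := huu ⟨a, ha⟩ ⟨b, hb⟩ ha'
    simpa [v, ha, hb, Fin.ext_iff] using this
  obtain ⟨f, hf⟩ := hv.exists_orthonormalBasis_extension_of_card_eq
    (by simp [hq] : Module.finrank 𝕜 W = Fintype.card (Fin q))
  refine ⟨fun k => Real.arccos (σ k), e, f, fun k => Real.arccos_nonneg _,
    fun k => Real.arccos_le_pi_div_two.2 (hσ0 _),
    fun a b hab => Real.antitone_arccos (hσa hab), ?_⟩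
  intro i j
  have h1 : inner 𝕜 (e i : X) (f j : X) = inner 𝕜 (T (e i)) (f j) := by
    have := W.inner_orthogonalProjectionOnto_eq_of_mem_right (f j) (e i : X)
    exact this.symm
  have hc : Real.cos (Real.arccos (σ i)) = σ i :=
    Real.cos_arccos (by linarith [hσ0 i]) (hle1 i)
  simp only [h1, hc]
  by_cases hi : σ i = 0
  · have h0 : T (e i) = 0 := by rw [← norm_eq_zero, hnorm, hi]
    simp [h0, hi]
  · have hiq := hlt i hi
    have h2 : f ⟨i, hiq⟩ = u i := by
      rw [hf ⟨i, hiq⟩ ⟨i.isLt, hi⟩]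
      exact dif_pos i.isLt
    rw [hTu i hi, ← h2, inner_smul_left, OrthonormalBasis.inner_eq_ite]
    by_cases hij : (i : ℕ) = j
    · simp [hij]
    · simp [Fin.ext_iff, hij]

/-- The principal angles `θ₁ ≤ … ≤ θ_m` of `V` and `W`. (They do not depend on the choice of
principal bases, as the `cos (θ i)` are the singular values of the projection `V → W`.) -/
noncomputable def principalAngles {𝕜 X : Type*} [RCLike 𝕜] [NormedAddCommGroup X]
    [InnerProductSpace 𝕜 X] [FiniteDimensional 𝕜 X] (V W : Submodule 𝕜 X) :
    Fin (min (Module.finrank 𝕜 V) (Module.finrank 𝕜 W)) → ℝ :=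
  (exists_isPrincipalAngles V W).choose

open Classical in
/-- The Grassmann angle `Θ_{V,W}` of `V` with `W`. -/
noncomputable def grassmannAngle {𝕜 X : Type*} [RCLike 𝕜] [NormedAddCommGroup X]
    [InnerProductSpace 𝕜 X] [FiniteDimensional 𝕜 X] (V W : Submodule 𝕜 X) : ℝ :=
  if V = ⊥ then 0
  else if W = ⊥ then Real.pi / 2
  else if Module.finrank 𝕜 V ≤ Module.finrank 𝕜 W then
    Real.arccos (∏ k, Real.cos (principalAngles V W k))
  else Real.pi / 2

/-- An asymmetric metric on a non-empty set `M`. -/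
structure IsAsymmetricMetric {M : Type*} (d : M → M → ℝ) : Prop where
  nonempty : Nonempty M
  nonneg : ∀ x y, 0 ≤ d x y
  eq_zero_iff : ∀ x y, (d x y = 0 ∧ d y x = 0) ↔ x = y
  triangle : ∀ x y z, d x z ≤ d x y + d y z

/-- The Grassmannian `G_k(X)` of the subspaces of `X` of dimension `k`. -/
def grassmannian (𝕜 X : Type*) [RCLike 𝕜] [NormedAddCommGroup X] [InnerProductSpace 𝕜 X]
    (k : ℕ) : Set (Submodule 𝕜 X) :=
  {V | Module.finrank 𝕜 V = k}

/-- The full Grassmannian `G(X)`, the union of the `G_k(X)` for `0 ≤ k ≤ dim X`. -/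
def fullGrassmannian (𝕜 X : Type*) [RCLike 𝕜] [NormedAddCommGroup X] [InnerProductSpace 𝕜 X] :
    Set (Submodule 𝕜 X) :=
  ⋃ k ∈ Set.Icc 0 (Module.finrank 𝕜 X), grassmannian 𝕜 X k

/-! For `p = dim V ≤ dim W`, `cos Θ_{V,W}` is the largest modulus of the inner product of the unit
blade of `V` with a unit `p`-blade of `W`, attained at the principal vectors. Thus triangles of
Grassmann angles reduce to triangles of lines in the exterior power, where the inner product of
blades is the determinant of `crossGram`. If `dim U ≤ dim V ≤ dim W`, let `y` in `V` attain
`Θ_{U,V}`, let `V'` be its span, and let `z` in `W` attain `Θ_{V',W}`. Then `Θ_{U,W} ≤ ∠(U,z) ≤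
∠(U,y) + ∠(y,z) = Θ_{U,V} + Θ_{V',W}`, and `Θ_{V',W} ≤ Θ_{V,W}` by `grassmannAngle_mono_left`.
Otherwise the right side contains `π / 2`, which bounds every Grassmann angle. If `Θ_{V,W} = 0`, all
cosines equal 1, so the principal vectors of `V` lie in `W`; two inclusions give equality. -/

/-! ### Determinants and angles between lines. -/

/-- A form of the Cauchy–Binet formula, summing over all maps between the index types. -/
theorem Matrix.sum_det_submatrix_mul_det_submatrix {R m n : Type*} [CommRing R] [Fintype m]
    [DecidableEq m] [Fintype n] [DecidableEq n] (A : Matrix m n R) (B : Matrix n m R) :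
    ∑ φ : m → n, (A.submatrix id φ).det * (B.submatrix φ id).det =
      (Fintype.card m).factorial * (A * B).det := by
  have h1 : (A * B).det = ∑ φ : m → n, (A.submatrix id φ).det * ∏ i, B (φ i) i := by
    simp only [Matrix.det_apply', Matrix.mul_apply, Finset.prod_univ_sum, Finset.mul_sum,
      Fintype.piFinset_univ, Finset.sum_mul]
    rw [Finset.sum_comm]
    simp [Finset.prod_mul_distrib, mul_assoc]
  -- Substituting `φ ∘ σ` for `φ` permutes the columns of the minor of `A`, which produces the sign
  -- of `σ`. Every `σ` therefore contributes the same amount.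
  have h2 (σ : Equiv.Perm m) :
      ∑ φ : m → n, (A.submatrix id φ).det * (Equiv.Perm.sign σ * ∏ i, B (φ (σ i)) i) =
        (A * B).det := by
    rw [h1]
    refine Fintype.sum_equiv (σ.arrowCongr (Equiv.refl n)).symm _ _ fun φ => ?_
    have h3 : A.submatrix id ((σ.arrowCongr (Equiv.refl n)).symm φ) =
        (A.submatrix id φ).submatrix id σ := rfl
    rw [h3, Matrix.det_permute']
    simp only [Equiv.arrowCongr_symm, Equiv.arrowCongr_apply, Equiv.symm_symm, Equiv.refl_symm,
      Equiv.coe_refl, Function.comp_apply, id_eq]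
    ring
  simp only [(B.submatrix _ id).det_apply', Matrix.submatrix_apply, id_eq, Finset.mul_sum]
  rw [Finset.sum_comm, Finset.sum_congr rfl fun σ _ => h2 σ]
  simp [Fintype.card_perm]

open scoped ComplexOrder in
/-- A special case of Hadamard's inequality. -/
theorem Matrix.norm_det_le_one_of_sum_norm_sq_le_one {𝕜 n : Type*} [RCLike 𝕜] [Fintype n]
    [DecidableEq n] (M : Matrix n n 𝕜) (hM : ∀ i, ∑ j, ‖M i j‖ ^ 2 ≤ 1) : ‖M.det‖ ≤ 1 := by
  have hA : (M * M.conjTranspose).PosSemidef := Matrix.posSemidef_self_mul_conjTranspose M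
  have hdet : ‖M.det‖ ^ 2 = ∏ i, hA.isHermitian.eigenvalues i := by
    have h := hA.isHermitian.det_eq_prod_eigenvalues
    rw [Matrix.det_mul, Matrix.det_conjTranspose, RCLike.star_def, RCLike.mul_conj] at h
    exact_mod_cast h
  have htr : ∑ i, hA.isHermitian.eigenvalues i = ∑ i, ∑ j, ‖M i j‖ ^ 2 := by
    have h := hA.isHermitian.trace_eq_sum_eigenvalues
    simp only [Matrix.trace, Matrix.diag_apply, Matrix.mul_apply, Matrix.conjTranspose_apply,
      RCLike.star_def, RCLike.mul_conj] at h
    exact_mod_cast h.symm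
  have hle : ‖M.det‖ ^ 2 ≤ 1 := by
    rw [hdet]
    -- The bound `t ≤ exp (t - 1)` plays the role of AM-GM: it turns the product of eigenvalues into
    -- their sum, the trace.
    calc ∏ i, hA.isHermitian.eigenvalues i
        ≤ ∏ i, Real.exp (hA.isHermitian.eigenvalues i - 1) :=
          Finset.prod_le_prod (fun i _ => hA.eigenvalues_nonneg i) fun i _ => by
            linarith [Real.add_one_le_exp (hA.isHermitian.eigenvalues i - 1)]
      _ = Real.exp (∑ i, (hA.isHermitian.eigenvalues i - 1)) := (Real.exp_sum _ _).symm
      _ ≤ 1 := by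
          rw [Real.exp_le_one_iff, Finset.sum_sub_distrib, htr, sub_nonpos]
          exact Finset.sum_le_sum fun i _ => hM i
  exact (sq_le_one_iff₀ (norm_nonneg _)).1 hle

/-- The triangle inequality for the angle between lines. -/
theorem arccos_norm_inner_le_add {𝕜 E : Type*} [RCLike 𝕜] [NormedAddCommGroup E]
    [InnerProductSpace 𝕜 E] {x y z : E} (hx : ‖x‖ = 1) (hy : ‖y‖ = 1) (hz : ‖z‖ = 1) :
    Real.arccos ‖(inner 𝕜 x z : 𝕜)‖ ≤
      Real.arccos ‖(inner 𝕜 x y : 𝕜)‖ + Real.arccos ‖(inner 𝕜 y z : 𝕜)‖ := by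
  -- Unit phases on `x` and `z` make their inner products with `y` real and nonnegative, so the real
  -- angles with `y` are the angles of the lines.
  have hphase (w : 𝕜) : ∃ u : 𝕜, ‖u‖ = 1 ∧ u * w = (‖w‖ : 𝕜) := by
    by_cases hw : w = 0
    · exact ⟨1, by simp, by simp [hw]⟩
    · refine ⟨(‖w‖ : 𝕜) / w, by simp [hw], by field_simp⟩
  obtain ⟨u, hu, hux⟩ := hphase (inner 𝕜 y x)
  obtain ⟨v, hv, hvz⟩ := hphase (inner 𝕜 y z)
  let : InnerProductSpace ℝ E := InnerProductSpace.rclikeToReal 𝕜 E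
  have hre (a b : E) : inner ℝ a b = RCLike.re (inner 𝕜 a b : 𝕜) := rfl
  have h := InnerProductGeometry.angle_le_angle_add_angle (u • x) y (v • z)
  have hxy : InnerProductGeometry.angle (u • x) y = Real.arccos ‖(inner 𝕜 x y : 𝕜)‖ := by
    rw [InnerProductGeometry.angle_comm, InnerProductGeometry.angle, hre, inner_smul_right, hux,
      norm_smul, hu, hx, hy, norm_inner_symm x y]
    simp
  have hyz : InnerProductGeometry.angle y (v • z) = Real.arccos ‖(inner 𝕜 y z : 𝕜)‖ := by
    rw [InnerProductGeometry.angle, hre, inner_smul_right, hvz, norm_smul, hv, hy, hz]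
    simp
  rw [hxy, hyz] at h
  refine le_trans (Real.antitone_arccos ?_) h
  rw [norm_smul, norm_smul, hu, hv, hx, hz, hre]
  calc _ ≤ ‖(inner 𝕜 (u • x) (v • z) : 𝕜)‖ := by simpa using RCLike.re_le_norm _
    _ = _ := by simp [inner_smul_left, inner_smul_right, hu, hv]

/-! ### Blades and their inner products. -/

/-- The matrix of inner products of two families of vectors. Its determinant is the inner product
of the blades spanned by the families. -/
def crossGram (𝕜 : Type*) {X m : Type*} [RCLike 𝕜] [NormedAddCommGroup X] [InnerProductSpace 𝕜 X]
    (x y : m → X) : Matrix m m 𝕜 :=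
  Matrix.of fun i j => inner 𝕜 (x i) (y j)

section crossGram

variable {𝕜 X m : Type*} [RCLike 𝕜] [NormedAddCommGroup X] [InnerProductSpace 𝕜 X] [Fintype m]
  [DecidableEq m]

/-- A concrete stand-in for the exterior power: up to scaling and conjugation, `Φ x` lists the
maximal minors of `x` in orthonormal coordinates, and Cauchy–Binet computes the inner product. -/
theorem exists_inner_eq_det_crossGram [FiniteDimensional 𝕜 X] :
    ∃ (n : ℕ) (Φ : (m → X) → EuclideanSpace 𝕜 (m → Fin n)),
      ∀ x y, inner 𝕜 (Φ x) (Φ y) = (crossGram 𝕜 x y).det := by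
  let o := stdOrthonormalBasis 𝕜 X
  let A : (m → X) → Matrix m (Fin (Module.finrank 𝕜 X)) 𝕜 := fun x =>
    Matrix.of fun i k => inner 𝕜 (x i) (o k)
  -- `r ^ 2` cancels the factorial that comes from summing over all maps. The `star` below
  -- compensates for conjugation in the first argument of `inner`.
  let r : ℝ := (√((Fintype.card m).factorial : ℝ))⁻¹
  refine ⟨_, fun x => WithLp.toLp 2 fun φ => (r : 𝕜) * star ((A x).submatrix id φ).det, ?_⟩
  intro x y
  have hAB : crossGram 𝕜 x y = A x * (A y).conjTranspose := by
    ext i j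
    simp [crossGram, A, Matrix.mul_apply, o.sum_inner_mul_inner]
  have hr : (r : 𝕜) * r * (Fintype.card m).factorial = 1 := by
    have : r * r * (Fintype.card m).factorial = 1 := by
      have h0 : (0 : ℝ) < (Fintype.card m).factorial := by positivity
      rw [← mul_inv, Real.mul_self_sqrt h0.le, inv_mul_cancel₀ h0.ne']
    exact_mod_cast this
  have hcb := Matrix.sum_det_submatrix_mul_det_submatrix (A x) (A y).conjTranspose
  calc _ = (r : 𝕜) * r * ∑ φ : m → Fin (Module.finrank 𝕜 X),
        ((A x).submatrix id φ).det * ((A y).conjTranspose.submatrix φ id).det := by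
        rw [PiLp.inner_apply, Finset.mul_sum]
        refine Finset.sum_congr rfl fun φ _ => ?_
        rw [← Matrix.conjTranspose_submatrix, Matrix.det_conjTranspose]
        simp
        ring
    _ = _ := by rw [hcb, hAB, ← mul_assoc, hr, one_mul]

theorem Orthonormal.det_crossGram_self {x : m → X} (hx : Orthonormal 𝕜 x) :
    (crossGram 𝕜 x x).det = 1 := by
  have : crossGram 𝕜 x x = 1 := by
    ext i j
    simp [crossGram, orthonormal_iff_ite.1 hx, Matrix.one_apply]
  rw [this, Matrix.det_one]

theorem arccos_norm_det_crossGram_le_add [FiniteDimensional 𝕜 X] {x y z : m → X}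
    (hx : Orthonormal 𝕜 x) (hy : Orthonormal 𝕜 y) (hz : Orthonormal 𝕜 z) :
    Real.arccos ‖(crossGram 𝕜 x z).det‖ ≤
      Real.arccos ‖(crossGram 𝕜 x y).det‖ + Real.arccos ‖(crossGram 𝕜 y z).det‖ := by
  obtain ⟨n, Φ, hΦ⟩ := exists_inner_eq_det_crossGram (𝕜 := 𝕜) (X := X) (m := m)
  have hnorm {w : m → X} (hw : Orthonormal 𝕜 w) : ‖Φ w‖ = 1 := by
    have h := hΦ w w
    rw [hw.det_crossGram_self, inner_self_eq_norm_sq_to_K] at h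
    have h' : ‖Φ w‖ ^ 2 = 1 := by exact_mod_cast h
    exact (pow_eq_one_iff_of_nonneg (norm_nonneg _) two_ne_zero).1 h'
  simpa only [hΦ] using arccos_norm_inner_le_add (𝕜 := 𝕜) (hnorm hx) (hnorm hy) (hnorm hz)

/-- Bessel's inequality bounds the rows, then Hadamard applies. The vectors `x i` need not be
orthogonal, which `grassmannAngle_mono_left` relies on. -/
theorem norm_det_crossGram_le_one {x y : m → X} (hx : ∀ i, ‖x i‖ = 1) (hy : Orthonormal 𝕜 y) :
    ‖(crossGram 𝕜 x y).det‖ ≤ 1 := by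
  refine Matrix.norm_det_le_one_of_sum_norm_sq_le_one _ fun i => ?_
  have h := hy.sum_inner_products_le (x i) (s := Finset.univ)
  rw [hx i, one_pow] at h
  simpa only [crossGram, Matrix.of_apply, norm_inner_symm (x i)] using h

/-- Changing the orthonormal basis multiplies the blade by a unitary determinant, of modulus 1. -/
theorem norm_det_crossGram_eq_of_orthonormalBasis {V : Submodule 𝕜 X}
    (b e : OrthonormalBasis m 𝕜 V) (y : m → X) :
    ‖(crossGram 𝕜 (fun i => (b i : X)) y).det‖ = ‖(crossGram 𝕜 (fun i => (e i : X)) y).det‖ := by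
  have h : crossGram 𝕜 (fun i => (b i : X)) y =
      b.toBasis.toMatrix e * crossGram 𝕜 (fun i => (e i : X)) y := by
    ext i j
    have hb : (b i : X) = ∑ k, inner 𝕜 (e k) (b i) • (e k : X) := by
      conv_lhs => rw [← e.sum_repr' (b i)]
      simp
    simp only [crossGram, Matrix.of_apply, Matrix.mul_apply]
    rw [hb, sum_inner]
    refine Finset.sum_congr rfl fun k _ => ?_
    rw [inner_smul_left, inner_conj_symm, Module.Basis.toMatrix_apply]
    simp [b.repr_apply_apply]
  have h1 : ‖(b.toBasis.toMatrix e).det‖ = 1 := b.det_to_matrix_orthonormalBasis e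
  rw [h, Matrix.det_mul, norm_mul, h1, one_mul]

/-- Used to replace principal vectors by their projections, pulling the cosines out row by row. -/
theorem norm_det_crossGram_of_inner_eq_mul {x y z : m → X} {c : m → ℝ}
    (h : ∀ i j, inner 𝕜 (x i) (z j) = (c i : 𝕜) * inner 𝕜 (y i) (z j)) (hc : ∀ i, 0 ≤ c i) :
    ‖(crossGram 𝕜 x z).det‖ = (∏ i, c i) * ‖(crossGram 𝕜 y z).det‖ := by
  have : crossGram 𝕜 x z = Matrix.of fun i j => (c i : 𝕜) * crossGram 𝕜 y z i j := by
    ext i j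
    exact h i j
  rw [this, Matrix.det_mul_column, norm_mul, norm_prod]
  simp [abs_of_nonneg (hc _)]

end crossGram

/-! ### Principal vectors and the vanishing of the Grassmann angle. -/

section grassmannAngle

variable {𝕜 X : Type*} [RCLike 𝕜] [NormedAddCommGroup X] [InnerProductSpace 𝕜 X]
  [FiniteDimensional 𝕜 X]

/-- For `dim V ≤ dim W`, there are an orthonormal basis `e` of `V` and an orthonormal family `f` in
`W` such that the projection of `e i` to `W` is `c i • f i`, and the Grassmann angle of `V` with `W`
has cosine `∏ i, c i`. -/
theorem exists_grassmannAngle_eq_arccos_prod {V W : Submodule 𝕜 X} {p : ℕ}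
    (hp : Module.finrank 𝕜 V = p) (hVW : Module.finrank 𝕜 V ≤ Module.finrank 𝕜 W) :
    ∃ (e : OrthonormalBasis (Fin p) 𝕜 V) (f : Fin p → X) (c : Fin p → ℝ),
      Orthonormal 𝕜 f ∧ (∀ i, f i ∈ W) ∧ (∀ i, 0 ≤ c i) ∧ (∀ i, c i ≤ 1) ∧
      (∀ i, ∀ w ∈ W, inner 𝕜 (e i : X) w = (c i : 𝕜) * inner 𝕜 (f i) w) ∧
      grassmannAngle V W = Real.arccos (∏ i, c i) := by
  subst hp
  obtain ⟨e, f, h⟩ := (exists_isPrincipalAngles V W).choose_spec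
  change IsPrincipal V W e f (principalAngles V W) at h
  have hmin : Module.finrank 𝕜 V = min (Module.finrank 𝕜 V) (Module.finrank 𝕜 W) :=
    (min_eq_left hVW).symm
  refine ⟨e, fun i => f (Fin.castLE hVW i),
    fun i => Real.cos (principalAngles V W (Fin.cast hmin i)), ?_, fun i => (f _).2, fun i => ?_,
    fun i => Real.cos_le_one _, fun i w hw => ?_, ?_⟩
  · exact (f.orthonormal.comp_linearIsometry W.subtypeₗᵢ).comp _ (Fin.castLE_injective hVW)
  · exact Real.cos_nonneg_of_mem_Icc
      ⟨by linarith [h.nonneg (Fin.cast hmin i), Real.pi_pos], h.le_pi_div_two _⟩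
  · have hw' : w = ∑ j, inner 𝕜 (f j : X) w • (f j : X) := by
      have := congrArg (Subtype.val) (f.sum_repr' ⟨w, hw⟩)
      simpa using this.symm
    conv_lhs => rw [hw']
    rw [inner_sum, Finset.sum_eq_single (Fin.castLE hVW i)]
    · rw [inner_smul_right, h.inner_eq, dif_pos (by simp), mul_comm]
      rfl
    · intro j _ hj
      rw [inner_smul_right, h.inner_eq, dif_neg, mul_zero]
      exact fun hij => hj (Fin.ext hij.symm)
    · simp
  · have hprod : ∏ i, Real.cos (principalAngles V W (Fin.cast hmin i)) =
        ∏ k, Real.cos (principalAngles V W k) :=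
      Fintype.prod_equiv (finCongr hmin) _ _ fun _ => rfl
    rw [hprod, grassmannAngle]
    -- For `V = ⊥` the product is empty, and `arccos 1 = 0` agrees with the convention.
    by_cases hV : V = ⊥
    · have : IsEmpty (Fin (min (Module.finrank 𝕜 V) (Module.finrank 𝕜 W))) := by
        rw [← hmin, hV, finrank_bot]
        infer_instance
      simp [hV]
    · have hW : W ≠ ⊥ := by
        rintro rfl
        rw [finrank_bot, Nat.le_zero, Submodule.finrank_eq_zero] at hVW
        exact hV hVW
      rw [if_neg hV, if_neg hW, if_pos hVW]

theorem grassmannAngle_of_finrank_lt {V W : Submodule 𝕜 X}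
    (h : Module.finrank 𝕜 W < Module.finrank 𝕜 V) : grassmannAngle V W = Real.pi / 2 := by
  have hV : V ≠ ⊥ := by
    rintro rfl
    simp at h
  rw [grassmannAngle, if_neg hV, if_neg h.not_ge, ite_self]

theorem grassmannAngle_nonneg (V W : Submodule 𝕜 X) : 0 ≤ grassmannAngle V W := by
  unfold grassmannAngle
  split_ifs
  exacts [le_rfl, by positivity, Real.arccos_nonneg _, by positivity]

theorem grassmannAngle_le_pi_div_two (V W : Submodule 𝕜 X) :
    grassmannAngle V W ≤ Real.pi / 2 := by
  rcases le_or_gt (Module.finrank 𝕜 V) (Module.finrank 𝕜 W) with h | h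
  · obtain ⟨e, f, c, -, -, hc, -, -, hΘ⟩ := exists_grassmannAngle_eq_arccos_prod rfl h
    rw [hΘ, Real.arccos_le_pi_div_two]
    exact Finset.prod_nonneg fun i _ => hc i
  · exact (grassmannAngle_of_finrank_lt h).le

theorem grassmannAngle_self (V : Submodule 𝕜 X) : grassmannAngle V V = 0 := by
  obtain ⟨e, f, c, hf, -, hc0, hc1, hef, hΘ⟩ :=
    exists_grassmannAngle_eq_arccos_prod (V := V) rfl le_rfl
  rw [hΘ, Real.arccos_eq_zero]
  refine (Finset.prod_eq_one fun i _ => le_antisymm (hc1 i) ?_).ge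
  have he : ‖(e i : X)‖ = 1 := e.orthonormal.1 i
  -- Testing the projection identity on `e i` itself gives `1 = c i * ‖⟪f i, e i⟫‖ ≤ c i`.
  have h := congrArg norm (hef i (e i) (e i).2)
  rw [inner_self_eq_norm_sq_to_K, he, norm_mul, RCLike.norm_ofReal, abs_of_nonneg (hc0 i)] at h
  have h1 : ‖(inner 𝕜 (f i) (e i : X) : 𝕜)‖ ≤ 1 := by
    simpa [he, hf.1 i] using norm_inner_le_norm (𝕜 := 𝕜) (f i) (e i : X)
  have h2 : 1 = c i * ‖(inner 𝕜 (f i) (e i : X) : 𝕜)‖ := by simpa using h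
  nlinarith [hc0 i]

/-- The Grassmann angle of `V` with `W` vanishes only if `V ≤ W`. -/
theorem le_of_grassmannAngle_eq_zero {V W : Submodule 𝕜 X} (h : grassmannAngle V W = 0) :
    V ≤ W := by
  rcases le_or_gt (Module.finrank 𝕜 V) (Module.finrank 𝕜 W) with hVW | hVW
  · obtain ⟨e, f, c, hf, hfW, hc0, hc1, hef, hΘ⟩ := exists_grassmannAngle_eq_arccos_prod rfl hVW
    rw [hΘ, Real.arccos_eq_zero] at h
    have hc (i) : c i = 1 := by
      refine le_antisymm (hc1 i) (h.trans ?_)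
      rw [← Finset.mul_prod_erase _ _ (Finset.mem_univ i)]
      exact mul_le_of_le_one_right (hc0 i)
        (Finset.prod_le_one (fun j _ => hc0 j) fun j _ => hc1 j)
    have heW (i) : (e i : X) ∈ W := by
      have h1 : inner 𝕜 (e i : X) (f i) = (1 : 𝕜) := by
        rw [hef i _ (hfW i), hc, inner_self_eq_norm_sq_to_K, hf.1 i]
        simp
      have he : ‖(e i : X)‖ = 1 := e.orthonormal.1 i
      rw [(inner_eq_one_iff_of_norm_eq_one he (hf.1 i)).1 h1]
      exact hfW i
    intro v hv
    have hv' : v = ∑ i, inner 𝕜 (e i : X) v • (e i : X) := by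
      have := congrArg (Subtype.val) (e.sum_repr' ⟨v, hv⟩)
      simpa using this.symm
    rw [hv']
    exact W.sum_mem fun i _ => W.smul_mem _ (heW i)
  · rw [grassmannAngle_of_finrank_lt hVW] at h
    exact absurd h (by positivity)

/-! ### The Grassmann angle as a minimum over blades, and the triangle inequality. -/

/-- The Grassmann angle is at most the angle between the blades of an orthonormal basis of `V` and
of an orthonormal family in `W`. -/
theorem grassmannAngle_le_arccos_norm_det_crossGram {V W : Submodule 𝕜 X} {p : ℕ}
    (b : OrthonormalBasis (Fin p) 𝕜 V) {y : Fin p → X} (hy : Orthonormal 𝕜 y)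
    (hyW : ∀ i, y i ∈ W) :
    grassmannAngle V W ≤ Real.arccos ‖(crossGram 𝕜 (fun i => (b i : X)) y).det‖ := by
  have hp : Module.finrank 𝕜 V = p := by simpa using Module.finrank_eq_card_basis b.toBasis
  have hVW : Module.finrank 𝕜 V ≤ Module.finrank 𝕜 W := by
    have hy' : Orthonormal 𝕜 (fun i => (⟨y i, hyW i⟩ : W)) :=
      (LinearIsometry.orthonormal_comp_iff W.subtypeₗᵢ).1 hy
    simpa [hp] using hy'.linearIndependent.fintype_card_le_finrank
  obtain ⟨e, f, c, hf, -, hc0, -, hef, hΘ⟩ := exists_grassmannAngle_eq_arccos_prod hp hVW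
  rw [hΘ, norm_det_crossGram_eq_of_orthonormalBasis b e,
    norm_det_crossGram_of_inner_eq_mul (fun i j => hef i _ (hyW j)) hc0]
  exact Real.antitone_arccos (mul_le_of_le_one_right (Finset.prod_nonneg fun i _ => hc0 i)
    (norm_det_crossGram_le_one hf.1 hy))

/-- The Grassmann angle is attained by the blade of an orthonormal family in `W`. -/
theorem exists_grassmannAngle_eq_arccos_norm_det_crossGram {V W : Submodule 𝕜 X} {p : ℕ}
    (b : OrthonormalBasis (Fin p) 𝕜 V) (hVW : Module.finrank 𝕜 V ≤ Module.finrank 𝕜 W) :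
    ∃ y : Fin p → X, Orthonormal 𝕜 y ∧ (∀ i, y i ∈ W) ∧
      grassmannAngle V W = Real.arccos ‖(crossGram 𝕜 (fun i => (b i : X)) y).det‖ := by
  have hp : Module.finrank 𝕜 V = p := by simpa using Module.finrank_eq_card_basis b.toBasis
  obtain ⟨e, f, c, hf, hfW, hc0, -, hef, hΘ⟩ := exists_grassmannAngle_eq_arccos_prod hp hVW
  refine ⟨f, hf, hfW, ?_⟩
  rw [hΘ, norm_det_crossGram_eq_of_orthonormalBasis b e,
    norm_det_crossGram_of_inner_eq_mul (fun i j => hef i _ (hfW j)) hc0, hf.det_crossGram_self]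
  simp

/-- Extend a principal basis of `U` to an orthonormal basis of `V`. Against a family in `W`
attaining the angle of `V`, the rows from `U` release the factor `∏ i, c i = cos Θ_{U,W}`, and the
remaining determinant has modulus at most 1. -/
theorem grassmannAngle_mono_left {U V W : Submodule 𝕜 X} (hUV : U ≤ V)
    (hVW : Module.finrank 𝕜 V ≤ Module.finrank 𝕜 W) :
    grassmannAngle U W ≤ grassmannAngle V W := by
  have hle := Submodule.finrank_mono hUV
  obtain ⟨r, hr⟩ := Nat.exists_eq_add_of_le hle
  obtain ⟨e, f, c, hf, hfW, hc0, hc1, hef, hΘ⟩ :=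
    exists_grassmannAngle_eq_arccos_prod rfl (hle.trans hVW)
  -- The zeros are placeholders; the basis extension keeps only the entries indexed by
  -- `Fin.castAdd`.
  let v : Fin (Module.finrank 𝕜 U + r) → V :=
    Fin.append (fun i => Submodule.inclusion hUV (e i)) 0
  have hv : Orthonormal 𝕜 ((Set.range (Fin.castAdd r)).domRestrict v) := by
    rw [orthonormal_iff_ite]
    rintro ⟨_, i, rfl⟩ ⟨_, j, rfl⟩
    simpa [v, Submodule.coe_inner, Subtype.ext_iff] using orthonormal_iff_ite.1 e.orthonormal i j
  obtain ⟨d, hd⟩ := hv.exists_orthonormalBasis_extension_of_card_eq (by simpa using hr)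
  have hde (i) : (d (Fin.castAdd r i) : X) = e i := by
    rw [hd _ ⟨i, rfl⟩]
    simp [v]
  obtain ⟨y, hy, hyW, hΘ'⟩ := exists_grassmannAngle_eq_arccos_norm_det_crossGram d hVW
  let x : Fin (Module.finrank 𝕜 U + r) → X := Fin.append f fun i => (d (Fin.natAdd _ i) : X)
  have hx (i) : ‖x i‖ = 1 := by
    refine Fin.addCases (fun i => ?_) (fun i => ?_) i
    · simpa [x] using hf.1 i
    · have hdi : ‖(d (Fin.natAdd _ i) : X)‖ = 1 := d.orthonormal.1 _
      simpa [x] using hdi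
  have hdet : ‖(crossGram 𝕜 (fun i => (d i : X)) y).det‖ =
      (∏ i, Fin.append c (1 : Fin r → ℝ) i) * ‖(crossGram 𝕜 x y).det‖ := by
    refine norm_det_crossGram_of_inner_eq_mul (fun i j => ?_) fun i => ?_
    · refine Fin.addCases (fun i => ?_) (fun i => ?_) i
      · simpa [x, hde] using hef i _ (hyW j)
      · simp [x]
    · refine Fin.addCases (fun i => ?_) (fun i => ?_) i
      · simpa using hc0 i
      · simp
  rw [hΘ, hΘ', hdet, Fin.prod_univ_add]
  refine Real.antitone_arccos ?_
  simpa using mul_le_of_le_one_right (Finset.prod_nonneg fun i _ => hc0 i)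
    (norm_det_crossGram_le_one hx hy)

theorem grassmannAngle_triangle (U V W : Submodule 𝕜 X) :
    grassmannAngle U W ≤ grassmannAngle U V + grassmannAngle V W := by
  rcases le_or_gt (Module.finrank 𝕜 U) (Module.finrank 𝕜 V) with hUV | hUV
  · rcases le_or_gt (Module.finrank 𝕜 V) (Module.finrank 𝕜 W) with hVW | hVW
    · let a := stdOrthonormalBasis 𝕜 U
      have ha : Orthonormal 𝕜 (fun i => (a i : X)) :=
        a.orthonormal.comp_linearIsometry U.subtypeₗᵢ
      obtain ⟨y, hy, hyV, hΘ⟩ := exists_grassmannAngle_eq_arccos_norm_det_crossGram a hUV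
      -- `V` may have larger dimension than `U`; passing to the span of `y` keeps all three blades
      -- in the same degree.
      let b : OrthonormalBasis _ 𝕜 (Submodule.span 𝕜 (Set.range y)) :=
        (Module.Basis.span hy.linearIndependent).toOrthonormalBasis
          ((LinearIsometry.orthonormal_comp_iff (Submodule.subtypeₗᵢ _)).1
            (by simpa [Function.comp_def, Module.Basis.span_apply] using hy))
      have hb : (fun i => (b i : X)) = y := by
        ext i
        simp [b, Module.Basis.span_apply]
      have hle : Submodule.span 𝕜 (Set.range y) ≤ V := by
        rw [Submodule.span_le]
        rintro _ ⟨i, rfl⟩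
        exact hyV i
      obtain ⟨z, hz, hzW, hΘ'⟩ := exists_grassmannAngle_eq_arccos_norm_det_crossGram b
        ((Submodule.finrank_mono hle).trans hVW)
      rw [hb] at hΘ'
      calc grassmannAngle U W ≤ _ := grassmannAngle_le_arccos_norm_det_crossGram a hz hzW
        _ ≤ _ := arccos_norm_det_crossGram_le_add ha hy hz
        _ = grassmannAngle U V + grassmannAngle (Submodule.span 𝕜 (Set.range y)) W := by
          rw [hΘ, hΘ']
        _ ≤ _ := by grw [grassmannAngle_mono_left hle hVW]
    · rw [grassmannAngle_of_finrank_lt hVW]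
      linarith [grassmannAngle_le_pi_div_two U W, grassmannAngle_nonneg U V]
  · rw [grassmannAngle_of_finrank_lt hUV]
    linarith [grassmannAngle_le_pi_div_two U W, grassmannAngle_nonneg V W]

end grassmannAngle

theorem mainTheorem7 {𝕜 X : Type*} [RCLike 𝕜] [NormedAddCommGroup X] [InnerProductSpace 𝕜 X]
    [FiniteDimensional 𝕜 X] :
    IsAsymmetricMetric
      (fun V W : fullGrassmannian 𝕜 X =>
        grassmannAngle (V : Submodule 𝕜 X) (W : Submodule 𝕜 X)) where
  nonempty := ⟨⊥, Set.mem_biUnion (x := 0) (by simp) (finrank_bot 𝕜 X)⟩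
  nonneg V W := grassmannAngle_nonneg _ _
  eq_zero_iff V W := by
    constructor
    · rintro ⟨h₁, h₂⟩
      exact Subtype.ext (le_antisymm (le_of_grassmannAngle_eq_zero h₁)
        (le_of_grassmannAngle_eq_zero h₂))
    · rintro rfl
      exact ⟨grassmannAngle_self _, grassmannAngle_self _⟩
  triangle U V W := grassmannAngle_triangle _ _ _
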